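/- Let $\mathcal S$ and $\mathcal E$ be finite-dimensional quantum systems, let $U$ be a unitary on $\mathcal S\otimes\mathcal E$, and for a state (density matrix) $\beta$ of $\mathcal E$ let $\mathcal L_\beta(\rho)=\operatorname{tr}_{\mathcal E}[U(\rho\otimes\beta)U^\dagger]$ be the reduced dynamics map on matrices of $\mathcal S$. Let $\beta_1,\beta_2,\dots$ be a random sequence of states of $\mathcal E$ that is ergodic, i.e. the left shift is a measure-preserving ergodic transformation of the sequence space equipped with the law of $(\beta_n)_{n\ge1}$. Put $\Phi_n=\mathcal L_{\beta_n}\circ\cdots\circ\mathcal L_{\beta_1}$, so that the reservoir recursion $\rho_n=\mathcal L_{\beta_n}(\rho_{n-1})$ gives $\rho_n=\Phi_n(\rho_0)$, and let $\|A\|=\operatorname{tr}\sqrt{A^\dagger A}$ be the trace norm. Assume that for some $n$, with positive probability, $\Phi_n$ is strictly positive, i.e. it maps every nonzero positive semidefinite matrix to a positive definite matrix. Then the reservoir has the quantum echo state property along almost every input sequence: almost surely, for all initial states $\rho_0^{(1)},\rho_0^{(2)}$ of $\mathcal S$, $$\|\Phi_n(\rho_0^{(1)})-\Phi_n(\rho_0^{(2)})\|\longrightarrow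 0\qquad(n\to\infty).$$ Moreover the decay is exponential: there is a deterministic constant $\mu\in(0,1)$ such that almost surely there is a (random) constant $A>0$ with $$\|\Phi_n(\rho_0^{(1)})-\Phi_n(\rho_0^{(2)})\|\le A\,\mu^n\,\|\rho_0^{(1)}-\rho_0^{(2)}\|\qquad\text{for all } n\ge 0 \text{ and all states } \rho_0^{(1)},\rho_0^{(2)} \text{ of } \mathcal S.$$ -/

import Mathlib

open MeasureTheory Filter
open scoped Kronecker MatrixOrder ComplexOrder

noncomputable section

namespace QReservoir

/-- Quantum states of a finite-dimensional system: positive semidefinite matrices of trace one. -/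
def DensityMatrix (d : Type*) [Fintype d] : Type _ :=
  {ρ : Matrix d d ℂ // ρ.PosSemidef ∧ ρ.trace = 1}

namespace DensityMatrix

/-- The underlying matrix of a quantum state. -/
def mat {d : Type*} [Fintype d] (ρ : DensityMatrix d) : Matrix d d ℂ := ρ.1

/-- The subspace topology inherited from the space of matrices. -/
instance (d : Type*) [Fintype d] : TopologicalSpace (DensityMatrix d) :=
  inferInstanceAs (TopologicalSpace {ρ : Matrix d d ℂ // ρ.PosSemidef ∧ ρ.trace = 1})

/-- The Borel sigma-algebra. -/
instance (d : Type*) [Fintype d] : MeasurableSpace (DensityMatrix d) := borel _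

instance (d : Type*) [Fintype d] : BorelSpace (DensityMatrix d) := ⟨rfl⟩

end DensityMatrix

/-- The trace norm (Schatten 1-norm) `tr |A|`, with `|A| = √(A† A)`. -/
def traceNorm {d : Type*} [Fintype d] [DecidableEq d] (A : Matrix d d ℂ) : ℝ :=
  (CFC.sqrt (A.conjTranspose * A)).trace.re

/-- The trace distance `tr |A - B|`. -/
def traceDist {d : Type*} [Fintype d] [DecidableEq d] (A B : Matrix d d ℂ) : ℝ :=
  traceNorm (A - B)

/-- The partial trace over the second tensor factor. -/
def partialTrace {s e : Type*} [Fintype e] (M : Matrix (s × e) (s × e) ℂ) : Matrix s s ℂ :=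
  Matrix.of fun i j => ∑ k, M (i, k) (j, k)

/-- The reduced dynamics map `ρ ↦ tr_E [U (ρ ⊗ β) U†]`. -/
def reducedMap {s e : Type*} [Fintype s] [DecidableEq s] [Fintype e] [DecidableEq e]
    (U : Matrix.unitaryGroup (s × e) ℂ) (β : DensityMatrix e) :
    Matrix s s ℂ →ₗ[ℂ] Matrix s s ℂ where
  toFun ρ := partialTrace ((U : Matrix (s × e) (s × e) ℂ) * (ρ ⊗ₖ β.mat) *
    (U : Matrix (s × e) (s × e) ℂ).conjTranspose)
  map_add' ρ σ := by
    ext i j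
    simp [partialTrace, Matrix.add_kronecker, mul_add, add_mul, Finset.sum_add_distrib]
  map_smul' c ρ := by
    ext i j
    simp [partialTrace, Matrix.smul_kronecker, Finset.mul_sum]

/-- The composed map `Φ_n = L_{β_n} ∘ ⋯ ∘ L_{β_1}`. The sequence `b` is indexed from `0`, that is,
`b k` is the input `β_{k+1}` of the `(k+1)`-st interaction. The state after `n` interactions
started from `ρ₀` is `composedMap U b n ρ₀`. -/
def composedMap {s e : Type*} [Fintype s] [DecidableEq s] [Fintype e] [DecidableEq e]
    (U : Matrix.unitaryGroup (s × e) ℂ) (b : ℕ → DensityMatrix e) :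
    ℕ → (Matrix s s ℂ →ₗ[ℂ] Matrix s s ℂ)
  | 0 => LinearMap.id
  | n + 1 => reducedMap U (b n) ∘ₗ composedMap U b n

/-- A map is strictly positive if it sends every nonzero positive semidefinite matrix to a
positive definite matrix. -/
def IsStrictlyPositiveMap {s : Type*} [Fintype s] (Φ : Matrix s s ℂ →ₗ[ℂ] Matrix s s ℂ) : Prop :=
  ∀ A : Matrix s s ℂ, A.PosSemidef → A ≠ 0 → (Φ A).PosDef

/-- The quantum echo state property along the input sequence `b`: the trace distance between the
trajectories started from any two initial states tends to zero. -/
def EchoStateAlong {s e : Type*} [Fintype s] [DecidableEq s] [Fintype e] [DecidableEq e]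
    (U : Matrix.unitaryGroup (s × e) ℂ) (b : ℕ → DensityMatrix e) : Prop :=
  ∀ ρ σ : DensityMatrix s,
    Tendsto (fun n => traceDist (composedMap U b n ρ.mat) (composedMap U b n σ.mat)) atTop
      (nhds 0)

/-- A random sequence is ergodic if the left shift is an ergodic (in particular
measure-preserving) transformation of the sequence space with the law of the sequence. -/
def IsErgodicSequence {Ω X : Type*} [MeasurableSpace Ω] [MeasurableSpace X] (P : Measure Ω)
    (β : ℕ → Ω → X) : Prop :=
  (∀ n, Measurable (β n)) ∧
    Ergodic (fun (x : ℕ → X) (n : ℕ) => x (n + 1)) (P.map fun ω n => β n ω)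

end QReservoir

end

namespace QReservoir

section Ergodic

variable {α : Type*}

/-- The running maximum `max_{0 ≤ k ≤ n} ∑_{j < k} g (T^j x)` of the Birkhoff sums. -/
noncomputable def birkhoffMax (T : α → α) (g : α → ℝ) : ℕ → α → ℝ
  | 0 => fun _ => 0
  | n + 1 => fun x => max 0 (g x + birkhoffMax T g n (T x))

theorem birkhoffMax_nonneg (T : α → α) (g : α → ℝ) (n : ℕ) (x : α) :
    0 ≤ birkhoffMax T g n x := by
  cases n with
  | zero => exact le_rfl
  | succ n => exact le_max_left _ _

theorem birkhoffMax_le_succ (T : α → α) (g : α → ℝ) (n : ℕ) (x : α) :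
    birkhoffMax T g n x ≤ birkhoffMax T g (n + 1) x := by
  induction n generalizing x with
  | zero => exact le_max_left _ _
  | succ n ih => exact max_le_max le_rfl (by linarith [ih (T x)])

theorem birkhoffSum_le_birkhoffMax (T : α → α) (g : α → ℝ) (n : ℕ) (x : α) :
    birkhoffSum T g n x ≤ birkhoffMax T g n x := by
  induction n generalizing x with
  | zero => simp [birkhoffMax]
  | succ n ih =>
    rw [birkhoffSum_succ']
    exact le_max_of_le_right (by linarith [ih (T x)])

variable [MeasurableSpace α]

theorem measurable_birkhoffSum {T : α → α} {g : α → ℝ} (hT : Measurable T) (hg : Measurable g)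
    (n : ℕ) : Measurable (birkhoffSum T g n) :=
  Finset.measurable_fun_sum _ fun k _ => hg.comp (hT.iterate k)

theorem measurable_birkhoffMax {T : α → α} {g : α → ℝ} (hT : Measurable T) (hg : Measurable g)
    (n : ℕ) : Measurable (birkhoffMax T g n) := by
  induction n with
  | zero => exact measurable_const
  | succ n ih => exact measurable_const.max (hg.add (ih.comp hT))

variable {ν : Measure α}

theorem integrable_birkhoffMax {T : α → α} {g : α → ℝ} (hT : MeasurePreserving T ν ν)
    (hi : Integrable g ν) (n : ℕ) : Integrable (birkhoffMax T g n) ν := by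
  induction n with
  | zero => exact integrable_zero _ _ _
  | succ n ih => exact (integrable_zero _ _ _).sup (hi.add (hT.integrable_comp_of_integrable ih))

/-- **Maximal ergodic inequality.** -/
theorem setIntegral_birkhoffMax_pos_nonneg {T : α → α} {g : α → ℝ}
    (hT : MeasurePreserving T ν ν) (hg : Measurable g) (hi : Integrable g ν) (n : ℕ) :
    0 ≤ ∫ x in {x | 0 < birkhoffMax T g n x}, g x ∂ν := by
  cases n with
  | zero => simp [birkhoffMax]
  | succ n =>
    set M := birkhoffMax T g (n + 1) with hM
    have hMm : Measurable M := measurable_birkhoffMax hT.measurable hg _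
    have hMi : Integrable M ν := integrable_birkhoffMax hT hi _
    have hMT : Integrable (fun x => M (T x)) ν := hT.integrable_comp_of_integrable hMi
    have hS : MeasurableSet {x | 0 < M x} := measurableSet_lt measurable_const hMm
    have h1 : ∫ x in {x | 0 < M x}, (M x - M (T x)) ∂ν ≤ ∫ x in {x | 0 < M x}, g x ∂ν := by
      refine setIntegral_mono_on (hMi.sub hMT).integrableOn hi.integrableOn hS fun x hx => ?_
      have hx' : 0 < max 0 (g x + birkhoffMax T g n (T x)) := hx
      have h2 : M x = g x + birkhoffMax T g n (T x) := by
        rcases lt_max_iff.1 hx' with h | h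
        · exact absurd h (lt_irrefl _)
        · exact max_eq_right h.le
      linarith [birkhoffMax_le_succ T g n (T x)]
    refine le_trans ?_ h1
    rw [integral_sub hMi.integrableOn hMT.integrableOn]
    have h3 : ∫ x in {x | 0 < M x}, M x ∂ν = ∫ x, M x ∂ν :=
      setIntegral_eq_integral_of_forall_compl_eq_zero fun x hx =>
        le_antisymm (not_lt.1 hx) (birkhoffMax_nonneg T g _ x)
    have h4 : ∫ x in {x | 0 < M x}, M (T x) ∂ν ≤ ∫ x, M (T x) ∂ν :=
      setIntegral_le_integral hMT (Eventually.of_forall fun x => birkhoffMax_nonneg T g _ (T x))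
    have h5 : ∫ x, M (T x) ∂ν = ∫ x, M x ∂ν := by
      conv_rhs => rw [← hT.map_eq]
      exact (integral_map hT.measurable.aemeasurable hMm.aestronglyMeasurable).symm
    linarith

/-- If almost every orbit has a positive Birkhoff sum, then the integral is nonnegative. -/
theorem integral_nonneg_of_ae_exists_birkhoffSum_pos {T : α → α} {g : α → ℝ}
    (hT : MeasurePreserving T ν ν) (hg : Measurable g) (hi : Integrable g ν)
    (h : ∀ᵐ x ∂ν, ∃ n, 0 < birkhoffSum T g n x) : 0 ≤ ∫ x, g x ∂ν := by
  have hlim := tendsto_setIntegral_of_monotone (μ := ν) (f := g)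
    (s := fun n => {x | 0 < birkhoffMax T g n x})
    (fun n => measurableSet_lt measurable_const (measurable_birkhoffMax hT.measurable hg n))
    (monotone_nat_of_le_succ fun n x hx =>
      lt_of_lt_of_le (show 0 < birkhoffMax T g n x from hx) (birkhoffMax_le_succ T g n x))
    hi.integrableOn
  have huniv : (⋃ n, {x | 0 < birkhoffMax T g n x}) =ᵐ[ν] Set.univ := by
    refine eventuallyEq_univ.2 ?_
    filter_upwards [h] with x ⟨n, hn⟩
    exact Set.mem_iUnion.2 ⟨n, hn.trans_le (birkhoffSum_le_birkhoffMax T g n x)⟩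
  rw [setIntegral_congr_set huniv, setIntegral_univ] at hlim
  exact ge_of_tendsto' hlim fun n => setIntegral_birkhoffMax_pos_nonneg hT hg hi n

/-- For an ergodic transformation, the Birkhoff sums of a function of positive integral are
almost surely bounded below. -/
theorem ae_exists_neg_le_birkhoffSum {T : α → α} {g : α → ℝ} (hT : Ergodic T ν)
    (hg : Measurable g) (hi : Integrable g ν) (hpos : 0 < ∫ x, g x ∂ν) :
    ∀ᵐ x ∂ν, ∃ K : ℕ, ∀ n, -(K : ℝ) ≤ birkhoffSum T g n x := by
  have hmeas : MeasurableSet {x | ∃ K : ℕ, ∀ n, -(K : ℝ) ≤ birkhoffSum T g n x} := by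
    simp only [Set.ofPred_exists, Set.ofPred_forall]
    exact MeasurableSet.iUnion fun K => MeasurableSet.iInter fun n =>
      measurableSet_le measurable_const (measurable_birkhoffSum hT.measurable hg n)
  have hinv : T ⁻¹' {x | ∃ K : ℕ, ∀ n, -(K : ℝ) ≤ birkhoffSum T g n x} =
      {x | ∃ K : ℕ, ∀ n, -(K : ℝ) ≤ birkhoffSum T g n x} := by
    ext x
    constructor
    · rintro ⟨K, hK⟩
      obtain ⟨L, hL⟩ := exists_nat_ge (K - g x)
      refine ⟨L, fun n => ?_⟩
      cases n with
      | zero => simp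
      | succ n =>
        rw [birkhoffSum_succ']
        linarith [hK n]
    · rintro ⟨K, hK⟩
      obtain ⟨L, hL⟩ := exists_nat_ge (K + g x)
      refine ⟨L, fun n => ?_⟩
      have := hK (n + 1)
      rw [birkhoffSum_succ'] at this
      linarith
  rcases hT.toPreErgodic.ae_mem_or_ae_notMem hmeas hinv with h | h
  · exact h
  · exfalso
    have hneg : 0 ≤ ∫ x, (-g) x ∂ν := by
      refine integral_nonneg_of_ae_exists_birkhoffSum_pos hT.toMeasurePreserving hg.neg hi.neg ?_
      filter_upwards [h] with x hx
      have hx' : ¬ ∀ n, -((0 : ℕ) : ℝ) ≤ birkhoffSum T g n x := fun h0 => hx ⟨0, h0⟩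
      push Not at hx'
      obtain ⟨n, hn⟩ := hx'
      refine ⟨n, ?_⟩
      rw [birkhoffSum_neg]
      simpa using hn
    simp only [Pi.neg_apply, integral_neg] at hneg
    linarith

/-- Almost every orbit of an ergodic transformation visits a set of positive measure with positive
lower frequency. -/
theorem ae_exists_le_birkhoffSum_indicator [IsProbabilityMeasure ν] {T : α → α} (hT : Ergodic T ν)
    {G : Set α} (hG : MeasurableSet G) {δ : ℝ} (hδ : δ < ν.real G) :
    ∀ᵐ x ∂ν, ∃ K : ℕ, ∀ n : ℕ,
      δ * n - K ≤ birkhoffSum T (G.indicator fun _ => (1 : ℝ)) n x := by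
  have hi : Integrable (G.indicator fun _ => (1 : ℝ)) ν := (integrable_const 1).indicator hG
  have hint : ∫ x, (G.indicator (fun _ => (1 : ℝ)) x - δ) ∂ν = ν.real G - δ := by
    rw [integral_sub hi (integrable_const _), integral_indicator_const _ hG]
    simp
  have := ae_exists_neg_le_birkhoffSum hT ((measurable_const.indicator hG).sub measurable_const)
    (hi.sub (integrable_const δ)) (by
      refine lt_of_lt_of_eq ?_ hint.symm
      linarith)
  filter_upwards [this] with x ⟨K, hK⟩
  refine ⟨K, fun n => ?_⟩
  have h := hK n
  rw [birkhoffSum_sub] at h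
  have hc : birkhoffSum T (fun _ => δ) n x = δ * n := by simp [birkhoffSum, mul_comm]
  simp only [hc] at h
  linarith

end Ergodic

section Decay

/-- A nonincreasing sequence contracted by `c` over every window of length `N` that starts at a time
`j` with `f j = 1` decays at the rate given by the number of such times. -/
theorem pow_le_of_window_contraction {a f : ℕ → ℝ} {c : ℝ} {N : ℕ} (ha : ∀ n, 0 ≤ a n)
    (hanti : Antitone a) (hc : 0 < c) (hwin : ∀ j, a (j + N) ≤ c ^ f j * a j) (n : ℕ) :
    a (n + N) ^ (N + 1) ≤ c ^ (∑ j ∈ Finset.range n, f j) * a 0 ^ (N + 1) := by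
  have key : ∀ n, ∏ i ∈ Finset.range (N + 1), a (n + i) ≤
      c ^ (∑ j ∈ Finset.range n, f j) * a 0 ^ (N + 1) := by
    intro n
    induction n with
    | zero =>
      simp only [Finset.range_zero, Finset.sum_empty, Real.rpow_zero, one_mul, zero_add]
      calc ∏ i ∈ Finset.range (N + 1), a i ≤ ∏ _i ∈ Finset.range (N + 1), a 0 :=
            Finset.prod_le_prod (fun i _ => ha i) fun i _ => hanti (Nat.zero_le i)
        _ = a 0 ^ (N + 1) := by simp
    | succ n ih =>
      calc ∏ i ∈ Finset.range (N + 1), a (n + 1 + i)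
          = (∏ i ∈ Finset.range N, a (n + 1 + i)) * a (n + 1 + N) := Finset.prod_range_succ _ _
        _ ≤ (∏ i ∈ Finset.range N, a (n + 1 + i)) * (c ^ f n * a n) := by
            refine mul_le_mul_of_nonneg_left ?_ (Finset.prod_nonneg fun i _ => ha _)
            exact (hanti (by omega)).trans (hwin n)
        _ = c ^ f n * ∏ i ∈ Finset.range (N + 1), a (n + i) := by
            rw [Finset.prod_range_succ']
            have : ∀ i, a (n + (i + 1)) = a (n + 1 + i) := fun i => by congr 1; omega
            simp only [this, add_zero]
            ring
        _ ≤ c ^ f n * (c ^ (∑ j ∈ Finset.range n, f j) * a 0 ^ (N + 1)) :=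
            mul_le_mul_of_nonneg_left ih (Real.rpow_nonneg hc.le _)
        _ = _ := by rw [Finset.sum_range_succ, Real.rpow_add hc]; ring
  calc a (n + N) ^ (N + 1) = ∏ _i ∈ Finset.range (N + 1), a (n + N) := by simp
    _ ≤ ∏ i ∈ Finset.range (N + 1), a (n + i) :=
        Finset.prod_le_prod (fun _ _ => ha _) fun i hi =>
          hanti (by have := Finset.mem_range.1 hi; omega)
    _ ≤ _ := key n

/-- Exponential decay when the contracting windows have a positive lower frequency `δ`. -/
theorem le_exp_of_window_contraction {a f : ℕ → ℝ} {c δ : ℝ} {N K : ℕ} (ha : ∀ n, 0 ≤ a n)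
    (hanti : Antitone a) (hc : 0 < c) (hc1 : c < 1) (hδ : 0 ≤ δ)
    (hwin : ∀ j, a (j + N) ≤ c ^ f j * a j)
    (hf : ∀ n : ℕ, δ * n - K ≤ ∑ j ∈ Finset.range n, f j) (n : ℕ) :
    a n ≤ c ^ (-((K + δ * N) / (N + 1 : ℝ))) * (c ^ (δ / (N + 1 : ℝ))) ^ n * a 0 := by
  have hN : (0 : ℝ) < N + 1 := by positivity
  have hexp : c ^ (-((K + δ * N) / (N + 1 : ℝ))) * (c ^ (δ / (N + 1 : ℝ))) ^ n =
      c ^ ((δ * ((n : ℝ) - N) - K) / (N + 1)) := by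
    rw [← Real.rpow_natCast, ← Real.rpow_mul hc.le, ← Real.rpow_add hc]
    congr 1
    field_simp
    ring
  rw [hexp]
  rcases le_total n N with hn | hn
  · refine (hanti (Nat.zero_le n)).trans (le_mul_of_one_le_left (ha 0) ?_)
    refine Real.one_le_rpow_of_pos_of_le_one_of_nonpos hc hc1.le
      (div_nonpos_of_nonpos_of_nonneg ?_ hN.le)
    have : (n : ℝ) ≤ N := by exact_mod_cast hn
    have hK : (0 : ℝ) ≤ K := by positivity
    nlinarith
  · obtain ⟨m, rfl⟩ := Nat.exists_eq_add_of_le' hn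
    refine le_of_pow_le_pow_left₀ (Nat.succ_ne_zero N)
      (mul_nonneg (Real.rpow_nonneg hc.le _) (ha 0)) ?_
    refine (pow_le_of_window_contraction ha hanti hc hwin m).trans ?_
    rw [mul_pow, ← Real.rpow_natCast (c ^ _), ← Real.rpow_mul hc.le]
    refine mul_le_mul_of_nonneg_right ?_ (pow_nonneg (ha 0) _)
    refine Real.rpow_le_rpow_of_exponent_ge hc hc1.le (le_trans (le_of_eq ?_) (hf m))
    push_cast
    field_simp
    ring

end Decay

section TraceNorm

variable {d : Type*} [Fintype d] [DecidableEq d]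

theorem traceNorm_eq_trace_abs (A : Matrix d d ℂ) : traceNorm A = (CFC.abs A).trace.re := rfl

theorem traceNorm_nonneg (A : Matrix d d ℂ) : 0 ≤ traceNorm A := by
  rw [traceNorm_eq_trace_abs]
  exact (Complex.nonneg_iff.1 (Matrix.nonneg_iff_posSemidef.1 (CFC.abs_nonneg A)).trace_nonneg).1

theorem trace_mul_re_nonneg {A B : Matrix d d ℂ} (hA : A.PosSemidef) (hB : B.PosSemidef) :
    0 ≤ (A * B).trace.re := by
  obtain ⟨C, rfl⟩ := CStarAlgebra.nonneg_iff_eq_star_mul_self.mp hA.nonneg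
  rw [Matrix.star_eq_conjTranspose, Matrix.mul_assoc, Matrix.trace_mul_comm]
  exact (Complex.nonneg_iff.1 (hB.mul_mul_conjTranspose_same C).trace_nonneg).1

/-- The trace norm of a difference of positive semidefinite matrices is at most the sum of
their traces. -/
theorem traceNorm_sub_le {A B : Matrix d d ℂ} (hA : A.PosSemidef) (hB : B.PosSemidef) :
    traceNorm (A - B) ≤ A.trace.re + B.trace.re := by
  set H := A - B with hH
  have hsa : IsSelfAdjoint H := (hA.isHermitian.sub hB.isHermitian)
  have hcont (f : ℝ → ℝ) : ContinuousOn f (spectrum ℝ H) := H.finite_real_spectrum.continuousOn f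
  set S := cfc (fun x : ℝ => (SignType.sign x : ℝ)) H with hS
  have habs : CFC.abs H = S * H := by
    rw [CFC.abs_eq_cfc_norm H hsa]
    conv_rhs => rw [← cfc_id' ℝ H]
    rw [hS, ← cfc_mul _ _ H (hcont _) (hcont _)]
    exact cfc_congr fun x _ => by simp
  have h1 : (1 - S).PosSemidef := by
    rw [← Matrix.nonneg_iff_posSemidef, sub_nonneg]
    exact cfc_le_one _ _ fun x _ => by
      rcases lt_trichotomy x 0 with h | h | h <;> simp [h]
  have h2 : (1 + S).PosSemidef := by
    rw [← Matrix.nonneg_iff_posSemidef, ← cfc_one ℝ H, hS,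
      ← cfc_add (a := H) _ _ (hcont _) (hcont _)]
    exact cfc_nonneg fun x _ => by
      rcases lt_trichotomy x 0 with h | h | h <;> simp [h]
  have e1 := trace_mul_re_nonneg h1 hA
  have e2 := trace_mul_re_nonneg h2 hB
  rw [traceNorm_eq_trace_abs, habs, hH, mul_sub]
  simp only [sub_mul, add_mul, one_mul, Matrix.trace_sub, Matrix.trace_add, Complex.sub_re,
    Complex.add_re] at *
  linarith

theorem exists_posSemidef_sub_eq {H : Matrix d d ℂ} (hH : H.IsHermitian) :
    ∃ A B : Matrix d d ℂ, A.PosSemidef ∧ B.PosSemidef ∧ A - B = H ∧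
      A.trace.re + B.trace.re = traceNorm H := by
  refine ⟨H⁺, H⁻, Matrix.nonneg_iff_posSemidef.1 (CFC.posPart_nonneg H),
    Matrix.nonneg_iff_posSemidef.1 (CFC.negPart_nonneg H),
    CFC.posPart_sub_negPart H hH, ?_⟩
  rw [traceNorm_eq_trace_abs, ← CFC.posPart_add_negPart H hH, Matrix.trace_add, Complex.add_re]

end TraceNorm

section Entrywise

variable {d : Type*} [Fintype d]

theorem posSemidef_iff_re_dotProduct {M : Matrix d d ℂ} (hM : M.IsHermitian) :
    M.PosSemidef ↔ ∀ v : d → ℂ, 0 ≤ (star v ⬝ᵥ M.mulVec v).re := by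
  refine ⟨fun h v => (Complex.nonneg_iff.1 (h.dotProduct_mulVec_nonneg v)).1, fun h => ?_⟩
  refine Matrix.PosSemidef.of_dotProduct_mulVec_nonneg hM fun v => ?_
  exact Complex.nonneg_iff.2 ⟨h v, (hM.im_star_dotProduct_mulVec_self v).symm⟩

theorem isClosed_setOf_posSemidef : IsClosed {M : Matrix d d ℂ | M.PosSemidef} := by
  have : {M : Matrix d d ℂ | M.PosSemidef} =
      {M | M.conjTranspose = M} ∩ ⋂ v : d → ℂ, {M | 0 ≤ (star v ⬝ᵥ M.mulVec v).re} := by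
    ext M
    simp only [Set.mem_ofPred_eq, Set.mem_inter_iff, Set.mem_iInter]
    exact ⟨fun h => ⟨h.isHermitian, (posSemidef_iff_re_dotProduct h.isHermitian).1 h⟩,
      fun h => (posSemidef_iff_re_dotProduct h.1).2 h.2⟩
  rw [this]
  refine (isClosed_eq continuous_id.matrix_conjTranspose continuous_id).inter
    (isClosed_iInter fun v => isClosed_le continuous_const ?_)
  exact Complex.continuous_re.comp
    (continuous_const.dotProduct (continuous_id.matrix_mulVec continuous_const))

theorem re_star_dotProduct_self_le (v : d → ℂ) :
    (star v ⬝ᵥ v).re ≤ Fintype.card d * ‖v‖ ^ 2 := by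
  have : (star v ⬝ᵥ v).re = ∑ i, ‖v i‖ ^ 2 := by
    simp only [dotProduct, Pi.star_apply, Complex.re_sum, Complex.star_def]
    refine Finset.sum_congr rfl fun i _ => ?_
    rw [Complex.conj_mul']
    norm_cast
  rw [this]
  calc ∑ i, ‖v i‖ ^ 2 ≤ ∑ _i : d, ‖v‖ ^ 2 := by
        gcongr with i; exact norm_le_pi_norm v i
    _ = _ := by simp

attribute [local instance] Matrix.normedAddCommGroup Matrix.normedSpace

theorem re_trace_le (A : Matrix d d ℂ) : A.trace.re ≤ Fintype.card d * ‖A‖ := by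
  calc A.trace.re = ∑ i, (A i i).re := by simp [Matrix.trace]
    _ ≤ ∑ _i : d, ‖A‖ := by
        gcongr with i
        exact (Complex.re_le_norm _).trans (A.norm_entry_le_entrywise_sup_norm)
    _ = _ := by simp

end Entrywise

section PositiveMaps

variable {d : Type*} [Fintype d]

/-- A linear map of matrices that is positive and preserves the trace. -/
structure IsPositiveTracePreserving (Φ : Matrix d d ℂ →ₗ[ℂ] Matrix d d ℂ) : Prop where
  posSemidef : ∀ A : Matrix d d ℂ, A.PosSemidef → (Φ A).PosSemidef
  trace : ∀ A : Matrix d d ℂ, (Φ A).trace = A.trace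

variable [DecidableEq d]

/-- The map `Φ` dominates the completely depolarizing map: `Φ A ≥ ε (tr A) 1` for all positive
semidefinite `A`. -/
def IsMinorized (ε : ℝ) (Φ : Matrix d d ℂ →ₗ[ℂ] Matrix d d ℂ) : Prop :=
  ∀ A : Matrix d d ℂ, A.PosSemidef → (Φ A - (ε * A.trace) • (1 : Matrix d d ℂ)).PosSemidef

theorem IsPositiveTracePreserving.isMinorized_zero {Φ : Matrix d d ℂ →ₗ[ℂ] Matrix d d ℂ}
    (h : IsPositiveTracePreserving Φ) : IsMinorized 0 Φ := fun A hA => by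
  simpa using h.posSemidef A hA

theorem IsPositiveTracePreserving.isHermitian {Φ : Matrix d d ℂ →ₗ[ℂ] Matrix d d ℂ}
    (h : IsPositiveTracePreserving Φ) {H : Matrix d d ℂ} (hH : H.IsHermitian) :
    (Φ H).IsHermitian := by
  obtain ⟨A, B, hA, hB, rfl, -⟩ := exists_posSemidef_sub_eq hH
  rw [map_sub]
  exact (h.posSemidef A hA).isHermitian.sub (h.posSemidef B hB).isHermitian

/-- Doeblin contraction: a minorized positive trace-preserving map contracts the trace norm of
traceless Hermitian matrices. -/
theorem IsPositiveTracePreserving.traceNorm_map_le {Φ : Matrix d d ℂ →ₗ[ℂ] Matrix d d ℂ}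
    (h : IsPositiveTracePreserving Φ) {ε : ℝ} (hε : IsMinorized ε Φ)
    {H : Matrix d d ℂ} (hH : H.IsHermitian) (hH0 : H.trace = 0) :
    traceNorm (Φ H) ≤ (1 - ε * Fintype.card d) * traceNorm H := by
  obtain ⟨A, B, hA, hB, rfl, hn⟩ := exists_posSemidef_sub_eq hH
  have htr : A.trace = B.trace := by
    rwa [Matrix.trace_sub, sub_eq_zero] at hH0
  have hsub : Φ (A - B) = (Φ A - (ε * A.trace) • (1 : Matrix d d ℂ)) -
      (Φ B - (ε * B.trace) • (1 : Matrix d d ℂ)) := by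
    rw [htr, map_sub]; abel
  rw [hsub, ← hn]
  refine (traceNorm_sub_le (hε A hA) (hε B hB)).trans (le_of_eq ?_)
  simp only [Matrix.trace_sub, h.trace, Matrix.trace_smul, Matrix.trace_one, smul_eq_mul,
    Complex.sub_re, Complex.mul_re, Complex.ofReal_re, Complex.ofReal_im, Complex.natCast_re,
    Complex.natCast_im]
  ring

attribute [local instance] Matrix.normedAddCommGroup Matrix.normedSpace

/-- By compactness, a strictly positive map is minorized. -/
theorem IsStrictlyPositiveMap.exists_isMinorized {Φ : Matrix d d ℂ →ₗ[ℂ] Matrix d d ℂ}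
    (hΦ : IsStrictlyPositiveMap Φ) : ∃ ε : ℝ, 0 < ε ∧ IsMinorized ε Φ := by
  rcases isEmpty_or_nonempty d with hd | hd
  · refine ⟨1, one_pos, fun A _ => ?_⟩
    rw [Subsingleton.elim (Φ A - _) 0]
    exact .zero
  let q : Matrix d d ℂ × (d → ℂ) → ℝ := fun p => (star p.2 ⬝ᵥ (Φ p.1).mulVec p.2).re
  have hΦc : Continuous Φ := Φ.continuous_of_finiteDimensional
  have hq : Continuous q := Complex.continuous_re.comp (continuous_snd.star.dotProduct
    ((hΦc.comp continuous_fst).matrix_mulVec continuous_snd))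
  have hK : IsCompact ((Metric.sphere (0 : Matrix d d ℂ) 1 ∩ {M | M.PosSemidef}) ×ˢ
      Metric.sphere (0 : d → ℂ) 1) :=
    ((isCompact_sphere _ _).inter_right isClosed_setOf_posSemidef).prod (isCompact_sphere _ _)
  obtain ⟨c, hc, hcq⟩ := hK.exists_forall_le' (a := 0) hq.continuousOn (by
    rintro ⟨A, v⟩ ⟨⟨hA1, hA⟩, hv⟩
    have hA0 : A ≠ 0 := ne_zero_of_mem_unit_sphere ⟨A, hA1⟩
    have hv0 : v ≠ 0 := ne_zero_of_mem_unit_sphere ⟨v, hv⟩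
    exact (Complex.pos_iff.1 ((hΦ A hA hA0).dotProduct_mulVec_pos hv0)).1)
  have hcard : (0 : ℝ) < Fintype.card d := by exact_mod_cast Fintype.card_pos
  have hlow : ∀ A : Matrix d d ℂ, A.PosSemidef → ∀ v : d → ℂ,
      c * ‖A‖ * ‖v‖ ^ 2 ≤ (star v ⬝ᵥ (Φ A).mulVec v).re := by
    intro A hA v
    rcases eq_or_ne A 0 with rfl | hA0
    · simp
    rcases eq_or_ne v 0 with rfl | hv0
    · simp
    have hnA : 0 < ‖A‖ := norm_pos_iff.2 hA0
    have hnv : 0 < ‖v‖ := norm_pos_iff.2 hv0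
    have h := hcq (((‖A‖⁻¹ : ℝ) : ℂ) • A, ((‖v‖⁻¹ : ℝ) : ℂ) • v) ⟨⟨by
        simp [norm_smul, hnA.ne'], hA.smul (by
          rw [Complex.zero_le_real]; positivity)⟩, by
        simp [norm_smul, hnv.ne']⟩
    have hval : q (((‖A‖⁻¹ : ℝ) : ℂ) • A, ((‖v‖⁻¹ : ℝ) : ℂ) • v) =
        ‖A‖⁻¹ * (‖v‖⁻¹) ^ 2 * (star v ⬝ᵥ (Φ A).mulVec v).re := by
      simp only [q, map_smul, star_smul, Matrix.smul_mulVec, Matrix.mulVec_smul, smul_dotProduct,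
        dotProduct_smul, smul_eq_mul, Complex.star_def, Complex.conj_ofReal, Complex.re_ofReal_mul]
      ring
    rw [hval] at h
    calc c * ‖A‖ * ‖v‖ ^ 2
        ≤ ‖A‖⁻¹ * (‖v‖⁻¹) ^ 2 * (star v ⬝ᵥ (Φ A).mulVec v).re * ‖A‖ * ‖v‖ ^ 2 := by gcongr
      _ = _ := by field_simp
  refine ⟨c / (Fintype.card d) ^ 2, by positivity, fun A hA => ?_⟩
  have hΦA : (Φ A).IsHermitian := by
    rcases eq_or_ne A 0 with rfl | hA0
    · simp
    · exact (hΦ A hA hA0).isHermitian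
  have htr : A.trace = (A.trace.re : ℂ) := Complex.ext rfl (Complex.nonneg_iff.1 hA.trace_nonneg).2.symm
  have hher : (Φ A - (((c / (Fintype.card d) ^ 2 : ℝ) : ℂ) * A.trace) •
      (1 : Matrix d d ℂ)).IsHermitian := by
    refine hΦA.sub ?_
    rw [Matrix.IsHermitian, Matrix.conjTranspose_smul, Matrix.conjTranspose_one, htr]
    simp
  refine (posSemidef_iff_re_dotProduct hher).2 fun v => ?_
  have hv0 : 0 ≤ (star v ⬝ᵥ v).re :=
    (Complex.nonneg_iff.1 (dotProduct_star_self_nonneg v)).1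
  have hA0 := (Complex.nonneg_iff.1 hA.trace_nonneg).1
  have hval : (star v ⬝ᵥ (Φ A - (((c / (Fintype.card d) ^ 2 : ℝ) : ℂ) * A.trace) •
      (1 : Matrix d d ℂ)).mulVec v).re = (star v ⬝ᵥ (Φ A).mulVec v).re -
      c / (Fintype.card d) ^ 2 * (A.trace.re * (star v ⬝ᵥ v).re) := by
    rw [htr, ← Complex.ofReal_mul, Matrix.sub_mulVec, Matrix.smul_mulVec, Matrix.one_mulVec,
      dotProduct_sub, dotProduct_smul, smul_eq_mul, Complex.sub_re, Complex.re_ofReal_mul,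
      Complex.ofReal_re]
    ring
  rw [hval, sub_nonneg]
  refine le_trans ?_ (hlow A hA v)
  calc c / (Fintype.card d) ^ 2 * (A.trace.re * (star v ⬝ᵥ v).re)
      ≤ c / (Fintype.card d) ^ 2 *
        ((Fintype.card d * ‖A‖) * (Fintype.card d * ‖v‖ ^ 2)) := by
        gcongr
        · exact re_trace_le A
        · exact re_star_dotProduct_self_le v
    _ = c * ‖A‖ * ‖v‖ ^ 2 := by field_simp

end PositiveMaps

section ReducedDynamics

instance (d : Type*) [Fintype d] : SecondCountableTopology (DensityMatrix d) :=
  have : SecondCountableTopology (Matrix d d ℂ) :=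
    inferInstanceAs (SecondCountableTopology (d → d → ℂ))
  TopologicalSpace.Subtype.secondCountableTopology
    {ρ : Matrix d d ℂ | ρ.PosSemidef ∧ ρ.trace = 1}

theorem DensityMatrix.continuous_mat {d : Type*} [Fintype d] :
    Continuous (DensityMatrix.mat : DensityMatrix d → Matrix d d ℂ) := continuous_subtype_val

theorem posSemidef_partialTrace {s e : Type*} [Fintype e] {M : Matrix (s × e) (s × e) ℂ}
    (hM : M.PosSemidef) : (partialTrace M).PosSemidef := by
  have : partialTrace M = ∑ k, M.submatrix (fun i : s => (i, k)) fun i => (i, k) := by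
    ext i j
    simp [partialTrace, Matrix.sum_apply]
  rw [this]
  exact Matrix.posSemidef_sum _ fun k _ => hM.submatrix _

theorem trace_partialTrace {s e : Type*} [Fintype s] [Fintype e] (M : Matrix (s × e) (s × e) ℂ) :
    (partialTrace M).trace = M.trace := by
  simp [partialTrace, Matrix.trace, Fintype.sum_prod_type]

variable {s e : Type*} [Fintype s] [DecidableEq s] [Fintype e] [DecidableEq e]

theorem isPositiveTracePreserving_reducedMap (U : Matrix.unitaryGroup (s × e) ℂ)
    (β : DensityMatrix e) : IsPositiveTracePreserving (reducedMap U β) where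
  posSemidef A hA :=
    posSemidef_partialTrace ((hA.kronecker β.2.1).mul_mul_conjTranspose_same _)
  trace A := by
    have hU : (U : Matrix (s × e) (s × e) ℂ).conjTranspose * (U : Matrix (s × e) (s × e) ℂ) = 1 :=
      Matrix.mem_unitaryGroup_iff'.1 U.2
    have hβ : β.mat.trace = 1 := β.2.2
    change (partialTrace _).trace = _
    rw [trace_partialTrace, Matrix.trace_mul_comm, ← Matrix.mul_assoc, hU, Matrix.one_mul,
      Matrix.trace_kronecker, hβ, mul_one]

theorem isPositiveTracePreserving_composedMap (U : Matrix.unitaryGroup (s × e) ℂ)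
    (b : ℕ → DensityMatrix e) (n : ℕ) : IsPositiveTracePreserving (composedMap U b n) := by
  induction n with
  | zero => exact ⟨fun _ h => h, fun _ => rfl⟩
  | succ n ih =>
    have h := isPositiveTracePreserving_reducedMap U (b n)
    exact ⟨fun A hA => h.posSemidef _ (ih.posSemidef A hA),
      fun A => (h.trace _).trans (ih.trace A)⟩

theorem composedMap_add (U : Matrix.unitaryGroup (s × e) ℂ) (b : ℕ → DensityMatrix e) (j n : ℕ)
    (A : Matrix s s ℂ) : composedMap U b (j + n) A =
      composedMap U (fun k => b (k + j)) n (composedMap U b j A) := by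
  induction n with
  | zero => rfl
  | succ n ih =>
    change reducedMap U (b (j + n)) (composedMap U b (j + n) A) = reducedMap U (b (n + j)) _
    rw [ih, add_comm j n]

theorem continuous_composedMap (U : Matrix.unitaryGroup (s × e) ℂ) (n : ℕ) (A : Matrix s s ℂ) :
    Continuous fun b : ℕ → DensityMatrix e => composedMap U b n A := by
  induction n with
  | zero => exact continuous_const
  | succ n ih =>
    have hb : Continuous fun b : ℕ → DensityMatrix e => (b n).mat :=
      DensityMatrix.continuous_mat.comp (continuous_apply n)
    have hk : Continuous fun b : ℕ → DensityMatrix e => composedMap U b n A ⊗ₖ (b n).mat :=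
      continuous_matrix fun i j => (ih.matrix_elem i.1 j.1).mul (hb.matrix_elem i.2 j.2)
    have hc := (continuous_const.matrix_mul hk).matrix_mul
      (continuous_const (y := (U : Matrix (s × e) (s × e) ℂ).conjTranspose))
      (A := fun b => (U : Matrix (s × e) (s × e) ℂ) * (composedMap U b n A ⊗ₖ (b n).mat))
    exact continuous_matrix fun i j =>
      continuous_finsetSum _ fun k _ => hc.matrix_elem (i, k) (j, k)

theorem isClosed_setOf_isMinorized (U : Matrix.unitaryGroup (s × e) ℂ) (n : ℕ) (ε : ℝ) :
    IsClosed {b : ℕ → DensityMatrix e | IsMinorized ε (composedMap U b n)} := by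
  have : {b : ℕ → DensityMatrix e | IsMinorized ε (composedMap U b n)} =
      ⋂ (A : Matrix s s ℂ) (_ : A.PosSemidef), {b | (composedMap U b n A -
        (ε * A.trace) • (1 : Matrix s s ℂ)).PosSemidef} := by
    ext b
    simp [IsMinorized]
  rw [this]
  exact isClosed_iInter fun A => isClosed_iInter fun _ =>
    isClosed_setOf_posSemidef.preimage ((continuous_composedMap U n A).sub continuous_const)

theorem IsMinorized.mono {ε ε' : ℝ} {Φ : Matrix s s ℂ →ₗ[ℂ] Matrix s s ℂ} (h : IsMinorized ε Φ)
    (hε : ε' ≤ ε) : IsMinorized ε' Φ := fun A hA => by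
  have h1 : 0 ≤ ((ε - ε' : ℝ) : ℂ) * A.trace :=
    mul_nonneg (Complex.zero_le_real.2 (sub_nonneg.2 hε)) hA.trace_nonneg
  convert (h A hA).add (Matrix.PosSemidef.one.smul h1) using 1
  rw [sub_add, ← sub_smul]
  congr 2
  push_cast
  ring

/-- The shift on input sequences. -/
def shift {X : Type*} (x : ℕ → X) (n : ℕ) : X := x (n + 1)

theorem shift_iterate {X : Type*} (x : ℕ → X) (j : ℕ) : shift^[j] x = fun k => x (k + j) := by
  induction j with
  | zero => rfl
  | succ j ih =>
    rw [Function.iterate_succ_apply', ih]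
    funext k
    simp only [shift]
    congr 1
    omega

/-- Exponential forgetting along an input sequence that visits the set of minorized windows with
positive lower frequency. -/
theorem traceDist_composedMap_le (U : Matrix.unitaryGroup (s × e) ℂ) (b : ℕ → DensityMatrix e)
    {N K : ℕ} {ε c δ : ℝ} (hc : 0 < c) (hc1 : c < 1) (hεc : 1 - ε * Fintype.card s ≤ c)
    (hδ : 0 ≤ δ)
    (hK : ∀ n : ℕ, δ * n - K ≤ birkhoffSum shift
      ({b | IsMinorized ε (composedMap U b N)}.indicator fun _ => (1 : ℝ)) n b)
    (n : ℕ) (ρ σ : DensityMatrix s) :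
    traceDist (composedMap U b n ρ.mat) (composedMap U b n σ.mat) ≤
      c ^ (-((K + δ * N) / (N + 1 : ℝ))) * (c ^ (δ / (N + 1 : ℝ))) ^ n *
        traceDist ρ.mat σ.mat := by
  set H := ρ.mat - σ.mat with hHdef
  have hρ : ρ.mat.trace = 1 := ρ.2.2
  have hσ : σ.mat.trace = 1 := σ.2.2
  have hH : H.IsHermitian := Matrix.IsHermitian.sub ρ.2.1.isHermitian σ.2.1.isHermitian
  have hH0 : H.trace = 0 := by rw [hHdef, Matrix.trace_sub, hρ, hσ, sub_self]
  have hstep (j m : ℕ) {η : ℝ} (hη : IsMinorized η (composedMap U (fun k => b (k + j)) m)) :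
      traceNorm (composedMap U b (j + m) H) ≤
        (1 - η * Fintype.card s) * traceNorm (composedMap U b j H) := by
    have hj := isPositiveTracePreserving_composedMap U b j
    rw [composedMap_add]
    exact (isPositiveTracePreserving_composedMap U _ m).traceNorm_map_le hη (hj.isHermitian hH)
      ((hj.trace H).trans hH0)
  have hmono (j m : ℕ) :
      traceNorm (composedMap U b (j + m) H) ≤ traceNorm (composedMap U b j H) := by
    simpa using hstep j m (isPositiveTracePreserving_composedMap U _ m).isMinorized_zero
  have key := le_exp_of_window_contraction (a := fun j => traceNorm (composedMap U b j H))
    (f := fun j => {b | IsMinorized ε (composedMap U b N)}.indicator (fun _ => (1 : ℝ))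
      (shift^[j] b)) (N := N) (fun j => traceNorm_nonneg _)
    (antitone_nat_of_succ_le fun j => hmono j 1) hc hc1 hδ (fun j => ?_) hK n
  · rw [traceDist, traceDist, ← map_sub]
    exact key
  · by_cases hj : shift^[j] b ∈ {b | IsMinorized ε (composedMap U b N)}
    · rw [Set.indicator_of_mem hj, Real.rpow_one]
      rw [shift_iterate] at hj
      exact (hstep j N hj).trans (mul_le_mul_of_nonneg_right hεc (traceNorm_nonneg _))
    · rw [Set.indicator_of_notMem hj, Real.rpow_zero, one_mul]
      exact hmono j N

end ReducedDynamics

end QReservoir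

open QReservoir

theorem mainTheorem1 {s e Ω : Type*} [Fintype s] [DecidableEq s] [Fintype e] [DecidableEq e]
    [MeasurableSpace Ω] (P : Measure Ω) [IsProbabilityMeasure P]
    (U : Matrix.unitaryGroup (s × e) ℂ) (β : ℕ → Ω → QReservoir.DensityMatrix e)
    (hβ : QReservoir.IsErgodicSequence P β)
    (hpos : ∃ n : ℕ,
      0 < P {ω | QReservoir.IsStrictlyPositiveMap
        (QReservoir.composedMap U (fun k => β k ω) n)}) :
    (∀ᵐ ω ∂P, QReservoir.EchoStateAlong U (fun k => β k ω)) ∧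
    ∃ μ : ℝ, 0 < μ ∧ μ < 1 ∧
      ∀ᵐ ω ∂P, ∃ A : ℝ, 0 < A ∧ ∀ (n : ℕ) (ρ σ : QReservoir.DensityMatrix s),
        QReservoir.traceDist
            (QReservoir.composedMap U (fun k => β k ω) n ρ.mat)
            (QReservoir.composedMap U (fun k => β k ω) n σ.mat) ≤
          A * μ ^ n * QReservoir.traceDist ρ.mat σ.mat := by
  suffices h : ∃ μ : ℝ, 0 < μ ∧ μ < 1 ∧
      ∀ᵐ ω ∂P, ∃ A : ℝ, 0 < A ∧ ∀ (n : ℕ) (ρ σ : DensityMatrix s),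
        traceDist (composedMap U (fun k => β k ω) n ρ.mat)
            (composedMap U (fun k => β k ω) n σ.mat) ≤ A * μ ^ n * traceDist ρ.mat σ.mat by
    refine ⟨?_, h⟩
    obtain ⟨μ, h0, h1, h⟩ := h
    filter_upwards [h] with ω ⟨A, _, hA⟩ ρ σ
    refine squeeze_zero (fun n => traceNorm_nonneg _) (fun n => hA n ρ σ) ?_
    simpa using ((tendsto_pow_atTop_nhds_zero_of_lt_one h0.le h1).const_mul A).mul_const
      (traceDist ρ.mat σ.mat)
  rcases isEmpty_or_nonempty s with hs | hs
  · refine ⟨1 / 2, by norm_num, by norm_num, Eventually.of_forall fun ω => ⟨1, one_pos, ?_⟩⟩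
    intro n ρ
    have := ρ.2.2
    simp [Matrix.trace] at this
  obtain ⟨hmeas, herg⟩ := hβ
  obtain ⟨N, hN⟩ := hpos
  have hm : Measurable fun ω n => β n ω := measurable_pi_lambda _ hmeas
  set ν := P.map fun ω n => β n ω with hν
  have : IsProbabilityMeasure ν := Measure.isProbabilityMeasure_map hm.aemeasurable
  have hGm (ε : ℝ) :
      MeasurableSet {b : ℕ → DensityMatrix e | IsMinorized ε (composedMap U b N)} :=
    (isClosed_setOf_isMinorized U N ε).measurableSet
  obtain ⟨m, hm0⟩ : ∃ m : ℕ,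
      P {ω | IsMinorized (1 / (m + 1 : ℝ)) (composedMap U (fun k => β k ω) N)} ≠ 0 := by
    by_contra! hcon
    refine hN.ne' (measure_mono_null (fun ω hω => ?_) (measure_iUnion_null hcon))
    obtain ⟨ε, hε, hmin⟩ := IsStrictlyPositiveMap.exists_isMinorized hω
    obtain ⟨m, hm⟩ := exists_nat_one_div_lt hε
    exact Set.mem_iUnion.2 ⟨m, hmin.mono hm.le⟩
  set ε : ℝ := 1 / (m + 1 : ℝ) with hε
  have hε0 : 0 < ε := by positivity
  have hνG : 0 < ν.real {b | IsMinorized ε (composedMap U b N)} := by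
    refine ENNReal.toReal_pos ?_ (measure_ne_top _ _)
    rwa [hν, Measure.map_apply hm (hGm ε)]
  set δ := ν.real {b | IsMinorized ε (composedMap U b N)} / 2 with hδ
  have hδ0 : 0 < δ := by positivity
  set c : ℝ := max (1 / 2) (1 - ε * Fintype.card s) with hcdef
  have hc0 : 0 < c := lt_max_of_lt_left (by norm_num)
  have hcard : (0 : ℝ) < Fintype.card s := by exact_mod_cast Fintype.card_pos
  have hc1 : c < 1 := max_lt (by norm_num) (by linarith [mul_pos hε0 hcard])
  refine ⟨c ^ (δ / (N + 1 : ℝ)), Real.rpow_pos_of_pos hc0 _,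
    Real.rpow_lt_one hc0.le hc1 (by positivity), ?_⟩
  have hae := ae_of_ae_map hm.aemeasurable
    (ae_exists_le_birkhoffSum_indicator (T := shift) herg (hGm ε) (half_lt_self hνG))
  filter_upwards [hae] with ω ⟨K, hK⟩
  exact ⟨_, Real.rpow_pos_of_pos hc0 _, fun n ρ σ =>
    traceDist_composedMap_le U _ hc0 hc1 (le_max_right _ _) hδ0.le hK n ρ σ⟩
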